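/- Let $k<p$, $\mathbf W\in\mathbb R^{p\times k}$ with rows $\mathbf w_1,\dots,\mathbf w_p$, and $\sigma^2\ge 0$ with $\|\mathbf w_j\|_2^2+\sigma^2=1$ for all $j$. Let $\mathbf z$ be a random vector with the law of $\mathbf W\mathbf t+\boldsymbol\epsilon$, where $\mathbf t\sim\mathcal N_k(0,I_k)$ and $\boldsymbol\epsilon\sim\mathcal N_p(0,\sigma^2 I_p)$ are independent, and let $\mathbf x$ be the random vector with entries $x_j=g_j(z_j)$, where every $g_j:\mathbb R\to\mathbb R$ is strictly monotone (increasing or decreasing) and Lipschitz with constant $L$. (That is, $\mathbf x$ follows the low rank Gaussian copula with known parameters $\mathbf W$, $\sigma^2$, $g$ and has latent vector $\mathbf z$.) Fix the set $O\subseteq\{1,\dots,p\}$ of observed entries, let $M$ be its complement, and let $\mathbf W_O,\mathbf W_M$ be the submatrices of $\mathbf W$ formed by the rows in $O$ and in $M$. Let $\lambda_{\max}(\mathbf W_M)^2$ and $\lambda_{\min}(\mathbf W_O)^2$ be the largest eigenvalue of $\mathbf W_M^\top\mathbf W_M$ and the smallest eigenvalue of $\mathbf W_O^\top\mathbf W_O$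 respectively, so that $\lambda_{\max},\lambda_{\min}\ge 0$ are the largest and the smallest of the $k$ singular values (in particular $\lambda_{\min}(\mathbf W_O)=0$ if $|O|<k$), and assume $\sigma^2+\lambda_{\min}^2(\mathbf W_O)>0$ (which is automatic if $\sigma^2>0$). Impute the missing entries by $\hat x_j=g_j(\mathbb E[z_j\mid \mathbf x_O])$, $j\in M$, and let $$\mathrm{MSE}(\hat{\mathbf x})=\frac1{|M|}\sum_{j\in M}\bigl(\hat x_j-g_j(z_j)\bigr)^2 .$$ Then for every $t>0$, $$\Pr\left[\mathrm{MSE}(\hat{\mathbf x})>L^2\sigma^2\left(\sqrt{1+\frac{1-\sigma^2}{\sigma^2+\lambda_{\min}^2(\mathbf W_O)}}+\sqrt{2\left(1+\frac{\lambda_{\max}^2(\mathbf W_M)}{\sigma^2+\lambda_{\min}^2(\mathbf W_O)}\right)\frac{t}{|M|}}\right)^2\right]\le e^{-t}.$$ -/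

import Mathlib

open MeasureTheory ProbabilityTheory

noncomputable section

/-- The largest singular value of a real `m × n` matrix. -/
def sigmaMax {m n : Type*} [Fintype m] [Fintype n] [DecidableEq n] (A : Matrix m n ℝ) : ℝ :=
  (Matrix.toEuclideanLin A).singularValues 0

/-- The smallest of the `n` singular values of a real `m × n` matrix, counted with multiplicity:
the square root of the smallest eigenvalue of `Aᵀ * A` (so it is `0` when `m < n`). -/
def sigmaMin {m n : Type*} [Fintype m] [Fintype n] [DecidableEq n] (A : Matrix m n ℝ) : ℝ :=
  (Matrix.toEuclideanLin A).singularValues (Fintype.card n - 1)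

/-- The submatrix of `W` formed by the rows with index in `S`. -/
def rowsOf {p k : ℕ} (W : Matrix (Fin p) (Fin k) ℝ) (S : Finset (Fin p)) :
    Matrix S (Fin k) ℝ :=
  W.submatrix (fun i : S => (i : Fin p)) id

/-- The distribution `PPCA(W, σ²)` on `ℝ^p`: the law of `W t + ε`, where `t ~ N(0, I_k)` and
`ε ~ N(0, σ² I_p)` are independent. -/
def ppca {p k : ℕ} (W : Matrix (Fin p) (Fin k) ℝ) (σ : ℝ) :
    Measure (EuclideanSpace ℝ (Fin p)) :=
  ((multivariateGaussian (0 : EuclideanSpace ℝ (Fin k)) (1 : Matrix (Fin k) (Fin k) ℝ)).prod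
    (multivariateGaussian (0 : EuclideanSpace ℝ (Fin p))
      (σ ^ 2 • (1 : Matrix (Fin p) (Fin p) ℝ)))).map
    (fun q => Matrix.toEuclideanLin W q.1 + q.2)

/-- The random vector `x` follows the low rank Gaussian copula with parameters `W`, `σ²` and
`G = (g_1, …, g_p)`, and `z` is its latent normal vector. -/
structure IsLRGC {Ω : Type*} [MeasurableSpace Ω] (μ : Measure Ω) {p k : ℕ}
    (W : Matrix (Fin p) (Fin k) ℝ) (σ : ℝ) (g : Fin p → ℝ → ℝ)
    (x z : Ω → EuclideanSpace ℝ (Fin p)) : Prop where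
  lt : k < p
  monotone : ∀ j, Monotone (g j) ∨ Antitone (g j)
  unit_diag : ∀ j, (W * W.transpose + σ ^ 2 • (1 : Matrix (Fin p) (Fin p) ℝ)) j j = 1
  measurable : Measurable x
  law_latent : HasLaw z (ppca W σ) μ
  eq_apply : ∀ᵐ ω ∂μ, ∀ j, x ω j = g j (z ω j)

/-- The σ-algebra generated by the observed subvector `x_O`. -/
abbrev observedSigma {Ω : Type*} {p : ℕ} (x : Ω → EuclideanSpace ℝ (Fin p)) (O : Finset (Fin p)) :
    MeasurableSpace Ω :=
  MeasurableSpace.comap (fun (ω : Ω) (i : O) => x ω (i : Fin p)) inferInstance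

/-- The imputed value `g_j(E[z_j | x_O])` of the `j`-th entry, for `j ∉ O`. -/
def impute {Ω : Type*} [MeasurableSpace Ω] (μ : Measure Ω) {p : ℕ} (g : Fin p → ℝ → ℝ)
    (x z : Ω → EuclideanSpace ℝ (Fin p)) (O : Finset (Fin p)) (j : Fin p) : Ω → ℝ :=
  fun ω => g j ((μ[fun ω' => z ω' j | observedSigma x O]) ω)

/-- The mean squared error `‖G_M(ẑ_M) - G_M(z_M)‖² / |M|` of the imputation of the missing
entries `M = Oᶜ`, where `ẑ_M = E[z_M | x_O]`. -/
def imputationMSE {Ω : Type*} [MeasurableSpace Ω] (μ : Measure Ω) {p : ℕ} (g : Fin p → ℝ → ℝ)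
    (x z : Ω → EuclideanSpace ℝ (Fin p)) (O : Finset (Fin p)) : Ω → ℝ :=
  fun ω => (∑ j ∈ Oᶜ, (impute μ g x z O j ω - g j (z ω j)) ^ 2) / (Oᶜ.card : ℝ)

end

/-! Each `g j` is injective, so `x_O` carries the same information as `z_O`, and the latent vector
is Gaussian. Hence `E[z_M | x_O]` is the linear regression `A z_O` with `A = W_M N⁻¹ W_Oᵀ`, `N = σ²
I + W_Oᵀ W_O` (`condExp_latent_eq`). The Lipschitz bound reduces the MSE to `L² ‖r‖² / |M|` for the
residual `r = z_M - A z_O`, which is centred Gaussian with covariance `σ² (I + W_M N⁻¹ W_Mᵀ)`.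

Since `N ≥ σ² + λ_min²`, this covariance has trace at most `|M| σ² (1 + (1 - σ²) / (σ² + λ_min²))`,
by the unit diagonal, and largest eigenvalue at most `σ² (1 + λ_max² / (σ² + λ_min²))`. A Chernoff
bound for Gaussian vectors (`multivariateGaussian_norm_sq_tail`) gives `‖r‖ ≥ √T + √(2Bt)` with
probability at most `e^{-t}`, where `T` bounds the trace and `B` the eigenvalues. -/

/-! ### Extreme singular values as bounds on quadratic forms. -/

theorem LinearMap.norm_sq_eq_sum_eigenvalues {E F : Type*} [NormedAddCommGroup E]
    [InnerProductSpace ℝ E] [FiniteDimensional ℝ E] [NormedAddCommGroup F]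
    [InnerProductSpace ℝ F] [FiniteDimensional ℝ F] (T : E →ₗ[ℝ] F) {n : ℕ}
    (hn : Module.finrank ℝ E = n) (y : E) :
    ‖T y‖ ^ 2 = ∑ i : Fin n, T.singularValues i ^ 2 *
      inner ℝ (T.isSymmetric_adjoint_comp_self.eigenvectorBasis hn i) y ^ 2 := by
  set b := T.isSymmetric_adjoint_comp_self.eigenvectorBasis hn
  have h1 : ‖T y‖ ^ 2 = inner ℝ ((T.adjoint ∘ₗ T) y) y := by
    rw [LinearMap.comp_apply, LinearMap.adjoint_inner_left, real_inner_self_eq_norm_sq]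
  rw [h1, ← b.sum_inner_mul_inner]
  refine Finset.sum_congr rfl fun i _ => ?_
  rw [T.isSymmetric_adjoint_comp_self y (b i),
    T.isSymmetric_adjoint_comp_self.apply_eigenvectorBasis hn i, T.sq_singularValues_fin hn i,
    real_inner_smul_right, real_inner_comm]
  simp only [RCLike.ofReal_real_eq_id, id_eq]
  rw [real_inner_comm]
  ring

theorem LinearMap.norm_sq_le_singularValues_zero {E F : Type*} [NormedAddCommGroup E]
    [InnerProductSpace ℝ E] [FiniteDimensional ℝ E] [NormedAddCommGroup F]
    [InnerProductSpace ℝ F] [FiniteDimensional ℝ F] (T : E →ₗ[ℝ] F) (y : E) :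
    ‖T y‖ ^ 2 ≤ T.singularValues 0 ^ 2 * ‖y‖ ^ 2 := by
  rw [T.norm_sq_eq_sum_eigenvalues rfl,
    ← (T.isSymmetric_adjoint_comp_self.eigenvectorBasis rfl).sum_sq_inner_right y, Finset.mul_sum]
  gcongr with i
  · exact T.singularValues_nonneg _
  · exact T.singularValues_antitone (Nat.zero_le _)

theorem LinearMap.singularValues_finrank_sub_one_le_norm_sq {E F : Type*} [NormedAddCommGroup E]
    [InnerProductSpace ℝ E] [FiniteDimensional ℝ E] [NormedAddCommGroup F]
    [InnerProductSpace ℝ F] [FiniteDimensional ℝ F] (T : E →ₗ[ℝ] F) {n : ℕ}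
    (hn : Module.finrank ℝ E = n) (y : E) :
    T.singularValues (n - 1) ^ 2 * ‖y‖ ^ 2 ≤ ‖T y‖ ^ 2 := by
  rw [T.norm_sq_eq_sum_eigenvalues hn,
    ← (T.isSymmetric_adjoint_comp_self.eigenvectorBasis hn).sum_sq_inner_right y, Finset.mul_sum]
  gcongr with i
  · exact T.singularValues_nonneg _
  · exact T.singularValues_antitone (by have := i.2; omega)

theorem EuclideanSpace.norm_toLp_sq {ι : Type*} [Fintype ι] (v : ι → ℝ) :
    ‖WithLp.toLp 2 v‖ ^ 2 = v ⬝ᵥ v := by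
  rw [EuclideanSpace.real_norm_sq_eq]
  simp [dotProduct, sq]

theorem sigmaMin_sq_mul_dotProduct_le {m n : Type*} [Fintype m] [Fintype n] [DecidableEq n]
    (A : Matrix m n ℝ) (y : n → ℝ) :
    sigmaMin A ^ 2 * (y ⬝ᵥ y) ≤ (A.mulVec y) ⬝ᵥ (A.mulVec y) := by
  have h := (Matrix.toEuclideanLin A).singularValues_finrank_sub_one_le_norm_sq
    (finrank_euclideanSpace) (WithLp.toLp 2 y)
  rwa [Matrix.toLpLin_toLp, EuclideanSpace.norm_toLp_sq, EuclideanSpace.norm_toLp_sq] at h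

/-- With `w = Aᵀ v`, Cauchy–Schwarz on `w ⬝ᵥ w = v ⬝ᵥ A w` transfers the bound from `A` to `Aᵀ`, so
their singular values need not be compared. -/
theorem dotProduct_transpose_mulVec_le_sigmaMax {m n : Type*} [Fintype m] [Fintype n]
    [DecidableEq n] (A : Matrix m n ℝ) (v : m → ℝ) :
    (A.transpose.mulVec v) ⬝ᵥ (A.transpose.mulVec v) ≤ sigmaMax A ^ 2 * (v ⬝ᵥ v) := by
  have h := (Matrix.toEuclideanLin A).norm_sq_le_singularValues_zero
    (WithLp.toLp 2 (A.transpose.mulVec v))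
  rw [Matrix.toLpLin_toLp, EuclideanSpace.norm_toLp_sq, EuclideanSpace.norm_toLp_sq] at h
  set w := A.transpose.mulVec v with hw
  have h1 : w ⬝ᵥ w = v ⬝ᵥ A.mulVec w := by
    nth_rw 1 [hw]
    rw [Matrix.mulVec_transpose, ← Matrix.dotProduct_mulVec]
  have h2 : (v ⬝ᵥ A.mulVec w) ^ 2 ≤ (v ⬝ᵥ v) * (A.mulVec w ⬝ᵥ A.mulVec w) := by
    simpa [dotProduct, sq] using Finset.sum_mul_sq_le_sq_mul_sq Finset.univ v (A.mulVec w)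
  have h3 : 0 ≤ v ⬝ᵥ v := dotProduct_self_star_nonneg v
  have h4 : 0 ≤ w ⬝ᵥ w := dotProduct_self_star_nonneg w
  rw [← h1] at h2
  change A.mulVec w ⬝ᵥ A.mulVec w ≤ sigmaMax A ^ 2 * _ at h
  rcases h4.eq_or_lt with h0 | h0
  · rw [← h0]; positivity
  · have : (w ⬝ᵥ w) * (w ⬝ᵥ w) ≤ (sigmaMax A ^ 2 * (v ⬝ᵥ v)) * (w ⬝ᵥ w) := by
      nlinarith [mul_le_mul_of_nonneg_left h h3]
    exact le_of_mul_le_mul_right this h0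

/-! ### The ridge matrix and its inverse. -/

namespace Matrix

variable {m n : Type*} [Fintype m] [Fintype n] [DecidableEq m] [DecidableEq n]

/-- The matrix `s I + Aᵀ A`. -/
noncomputable def ridge (A : Matrix m n ℝ) (s : ℝ) : Matrix n n ℝ :=
  s • (1 : Matrix n n ℝ) + A.transpose * A

omit [DecidableEq m] in
theorem dotProduct_ridge_mulVec_ge (A : Matrix m n ℝ) (s : ℝ) (y : n → ℝ) :
    (s + sigmaMin A ^ 2) * (y ⬝ᵥ y) ≤ y ⬝ᵥ (ridge A s).mulVec y := by
  have h : y ⬝ᵥ (ridge A s).mulVec y = s * (y ⬝ᵥ y) + (A.mulVec y) ⬝ᵥ (A.mulVec y) := by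
    rw [ridge, add_mulVec, smul_mulVec, one_mulVec, dotProduct_add, dotProduct_smul, smul_eq_mul,
      ← mulVec_mulVec, dotProduct_mulVec, vecMul_transpose]
  rw [h, add_mul]
  gcongr
  exact sigmaMin_sq_mul_dotProduct_le A y

omit [DecidableEq m] in
theorem isUnit_det_ridge (A : Matrix m n ℝ) {s : ℝ} (h : 0 < s + sigmaMin A ^ 2) :
    IsUnit (ridge A s).det := by
  rw [isUnit_iff_ne_zero]
  intro h0
  obtain ⟨v, hv, hv0⟩ := exists_mulVec_eq_zero_iff.mpr h0
  have := dotProduct_ridge_mulVec_ge A s v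
  rw [hv0, dotProduct_zero] at this
  have hpos : 0 < v ⬝ᵥ v := by
    simpa using dotProduct_self_star_pos_iff.mpr hv
  nlinarith [mul_pos h hpos]

omit [DecidableEq m] in
theorem dotProduct_ridge_inv_mulVec_le (A : Matrix m n ℝ) {s : ℝ} (h : 0 < s + sigmaMin A ^ 2)
    (w : n → ℝ) :
    w ⬝ᵥ (ridge A s)⁻¹.mulVec w ≤ (w ⬝ᵥ w) / (s + sigmaMin A ^ 2) := by
  set y := (ridge A s)⁻¹.mulVec w with hy
  have hw : (ridge A s).mulVec y = w := by
    rw [hy, mulVec_mulVec, mul_nonsing_inv _ (isUnit_det_ridge A h), one_mulVec]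
  have h1 := dotProduct_ridge_mulVec_ge A s y
  rw [hw, dotProduct_comm y w] at h1
  have h2 : (w ⬝ᵥ y) ^ 2 ≤ (w ⬝ᵥ w) * (y ⬝ᵥ y) := by
    simpa [dotProduct, sq] using Finset.sum_mul_sq_le_sq_mul_sq Finset.univ w y
  have h3 : 0 ≤ w ⬝ᵥ w := dotProduct_self_star_nonneg w
  have h4 : 0 ≤ y ⬝ᵥ y := dotProduct_self_star_nonneg y
  rw [le_div_iff₀ h]
  rcases (le_trans (by positivity) h1 : 0 ≤ w ⬝ᵥ y).eq_or_lt with h0 | h0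
  · rw [← h0]; simpa using h3
  · refine le_of_mul_le_mul_right ?_ h0
    -- With `c = s + sigmaMin A ^ 2`: `c (w·y)² ≤ (w·w) c (y·y) ≤ (w·w)(w·y)`, then `w·y` cancels.
    nlinarith [mul_le_mul_of_nonneg_left h1 h3, mul_le_mul_of_nonneg_left h2 h.le]

end Matrix

/-! ### Algebra of the regression residual and its covariance. -/

section Residual

open Matrix

variable {p k : ℕ} (W : Matrix (Fin p) (Fin k) ℝ) (σ : ℝ) (O : Finset (Fin p))

/-- The matrix that selects the rows with index in `S`. -/
noncomputable def rowSelector {p : ℕ} (S : Finset (Fin p)) : Matrix S (Fin p) ℝ :=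
  rowsOf (1 : Matrix (Fin p) (Fin p) ℝ) S

/-- The covariance matrix of `PPCA(W, σ²)`. -/
noncomputable def ppcaCov : Matrix (Fin p) (Fin p) ℝ := W * Wᵀ + σ ^ 2 • 1

/-- The matrix of the regression of the missing entries on the observed ones. -/
noncomputable def regressionMatrix : Matrix (Oᶜ : Finset (Fin p)) O ℝ :=
  rowsOf W Oᶜ * (ridge (rowsOf W O) (σ ^ 2))⁻¹ * (rowsOf W O)ᵀ

/-- The matrix of the residuals of the regression of the missing entries on the observed ones. -/
noncomputable def residualMatrix : Matrix (Oᶜ : Finset (Fin p)) (Fin p) ℝ :=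
  rowSelector Oᶜ - regressionMatrix W σ O * rowSelector O

/-- The conditional covariance of the missing entries given the observed ones. -/
noncomputable def residualCov : Matrix (Oᶜ : Finset (Fin p)) (Oᶜ : Finset (Fin p)) ℝ :=
  σ ^ 2 • (1 + rowsOf W Oᶜ * (ridge (rowsOf W O) (σ ^ 2))⁻¹ * (rowsOf W Oᶜ)ᵀ)

theorem rowSelector_mul (S : Finset (Fin p)) : rowSelector S * W = rowsOf W S := by
  ext i j
  simp [rowSelector, rowsOf, mul_apply, one_apply]

theorem rowSelector_mul_transpose_self (S : Finset (Fin p)) :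
    rowSelector S * (rowSelector S)ᵀ = 1 := by
  ext i j
  simp only [rowSelector, rowsOf, mul_apply, one_apply, submatrix_apply, transpose_apply, id,
    ite_mul, one_mul, zero_mul, Finset.sum_ite_eq, Finset.mem_univ, if_true, Subtype.ext_iff]
  exact if_congr eq_comm rfl rfl

theorem rowSelector_compl_mul_transpose :
    rowSelector Oᶜ * (rowSelector O)ᵀ = 0 := by
  ext i j
  have := Finset.mem_compl.mp i.2
  simp only [rowSelector, rowsOf, mul_apply, one_apply, submatrix_apply, transpose_apply, id]
  simp
  rintro h
  exact this (h ▸ j.2)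

theorem rowsOf_mul_ppcaCov_mul (S : Finset (Fin p)) :
    rowSelector S * ppcaCov W σ = rowsOf W S * Wᵀ + σ ^ 2 • rowSelector S := by
  rw [ppcaCov, Matrix.mul_add, ← Matrix.mul_assoc, rowSelector_mul, Matrix.mul_smul, Matrix.mul_one]

theorem mul_transpose_rowSelector (S : Finset (Fin p)) :
    Wᵀ * (rowSelector S)ᵀ = (rowsOf W S)ᵀ := by
  rw [← transpose_mul, rowSelector_mul]

variable {σ O}

/-- The residual is uncorrelated with `z_O`. The push-through identity `key` moves the covariance of
`z_O` past `W_Oᵀ`, so only the `k × k` ridge matrix is inverted; the covariance of `z_O` itself may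
be singular when `σ = 0`. -/
theorem residualMatrix_mul_cov_mul_observed
    (h : 0 < σ ^ 2 + sigmaMin (rowsOf W O) ^ 2) :
    residualMatrix W σ O * ppcaCov W σ * (rowSelector O)ᵀ = 0 := by
  have hN := nonsing_inv_mul _ (isUnit_det_ridge (rowsOf W O) h)
  have key : (rowsOf W O)ᵀ * (rowsOf W O * (rowsOf W O)ᵀ + σ ^ 2 • 1) =
      ridge (rowsOf W O) (σ ^ 2) * (rowsOf W O)ᵀ := by
    rw [ridge, Matrix.mul_add, Matrix.add_mul, Matrix.mul_assoc]
    simp [add_comm]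
  rw [residualMatrix, Matrix.sub_mul, Matrix.mul_assoc (regressionMatrix W σ O),
    rowsOf_mul_ppcaCov_mul, rowsOf_mul_ppcaCov_mul, Matrix.sub_mul, Matrix.mul_assoc, Matrix.add_mul,
    Matrix.add_mul, Matrix.mul_assoc, Matrix.mul_assoc, mul_transpose_rowSelector, Matrix.smul_mul,
    Matrix.smul_mul, rowSelector_mul_transpose_self, rowSelector_compl_mul_transpose, regressionMatrix,
    Matrix.mul_assoc, key, Matrix.mul_assoc, ← Matrix.mul_assoc _ (ridge _ _), hN]
  simp

theorem residualMatrix_mul_cov_mul_self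
    (h : 0 < σ ^ 2 + sigmaMin (rowsOf W O) ^ 2) :
    residualMatrix W σ O * ppcaCov W σ * (residualMatrix W σ O)ᵀ = residualCov W σ O := by
  have hN := nonsing_inv_mul _ (isUnit_det_ridge (rowsOf W O) h)
  have h0 : rowSelector O * (rowSelector Oᶜ)ᵀ = 0 := by
    rw [← transpose_transpose (rowSelector O * _), transpose_mul, transpose_transpose,
      rowSelector_compl_mul_transpose, transpose_zero]
  have key : (rowsOf W O)ᵀ * (rowsOf W O) = ridge (rowsOf W O) (σ ^ 2) - σ ^ 2 • 1 := by
    rw [ridge]; abel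
  have h1 : (residualMatrix W σ O)ᵀ =
      (rowSelector Oᶜ)ᵀ - (rowSelector O)ᵀ * (regressionMatrix W σ O)ᵀ := by
    rw [residualMatrix, transpose_sub, transpose_mul]
  rw [h1, Matrix.mul_sub, ← Matrix.mul_assoc, residualMatrix_mul_cov_mul_observed W h,
    Matrix.zero_mul, sub_zero,
    residualMatrix, Matrix.sub_mul, Matrix.mul_assoc (regressionMatrix W σ O),
    rowsOf_mul_ppcaCov_mul, rowsOf_mul_ppcaCov_mul, Matrix.sub_mul, Matrix.mul_assoc, Matrix.add_mul,
    Matrix.add_mul, Matrix.mul_assoc, Matrix.mul_assoc, mul_transpose_rowSelector, Matrix.smul_mul,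
    Matrix.smul_mul, rowSelector_mul_transpose_self, h0, regressionMatrix, smul_zero, add_zero,
    Matrix.mul_assoc, Matrix.mul_assoc, ← Matrix.mul_assoc _ (rowsOf W O), key, residualCov,
    Matrix.sub_mul, Matrix.mul_sub, ← Matrix.mul_assoc _ (ridge _ _), hN]
  simp [Matrix.mul_sub, Matrix.mul_assoc, add_comm]

theorem dotProduct_residualCov_mulVec_le (h : 0 < σ ^ 2 + sigmaMin (rowsOf W O) ^ 2)
    (v : (Oᶜ : Finset (Fin p)) → ℝ) :
    v ⬝ᵥ (residualCov W σ O).mulVec v ≤ σ ^ 2 * (v ⬝ᵥ v +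
      ((rowsOf W Oᶜ)ᵀ.mulVec v ⬝ᵥ (rowsOf W Oᶜ)ᵀ.mulVec v) /
        (σ ^ 2 + sigmaMin (rowsOf W O) ^ 2)) := by
  have h1 : v ⬝ᵥ (residualCov W σ O).mulVec v = σ ^ 2 * (v ⬝ᵥ v +
      (rowsOf W Oᶜ)ᵀ.mulVec v ⬝ᵥ (ridge (rowsOf W O) (σ ^ 2))⁻¹.mulVec
        ((rowsOf W Oᶜ)ᵀ.mulVec v)) := by
    rw [residualCov, smul_mulVec, dotProduct_smul, smul_eq_mul, add_mulVec, dotProduct_add,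
      one_mulVec, ← mulVec_mulVec, ← mulVec_mulVec, dotProduct_mulVec v, ← mulVec_transpose]
  rw [h1]
  gcongr
  exact dotProduct_ridge_inv_mulVec_le _ h _

theorem dotProduct_residualCov_mulVec_le_sigmaMax (h : 0 < σ ^ 2 + sigmaMin (rowsOf W O) ^ 2)
    (v : (Oᶜ : Finset (Fin p)) → ℝ) :
    v ⬝ᵥ (residualCov W σ O).mulVec v ≤ σ ^ 2 * (1 + sigmaMax (rowsOf W Oᶜ) ^ 2 /
        (σ ^ 2 + sigmaMin (rowsOf W O) ^ 2)) * (v ⬝ᵥ v) := by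
  refine (dotProduct_residualCov_mulVec_le W h v).trans ?_
  rw [mul_assoc, add_mul, one_mul, div_mul_eq_mul_div]
  gcongr
  exact dotProduct_transpose_mulVec_le_sigmaMax _ v

/-- Testing on a basis vector picks out one row of `W`, whose squared norm is `1 - σ²` by the unit
diagonal; `sigmaMax` is not needed. -/
theorem trace_residualCov_le (h : 0 < σ ^ 2 + sigmaMin (rowsOf W O) ^ 2)
    (hW : ∀ j, (W * W.transpose + σ ^ 2 • (1 : Matrix (Fin p) (Fin p) ℝ)) j j = 1) :
    (residualCov W σ O).trace ≤ (Oᶜ.card : ℝ) * (σ ^ 2 * (1 + (1 - σ ^ 2) /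
        (σ ^ 2 + sigmaMin (rowsOf W O) ^ 2))) := by
  have hj : ∀ j : (Oᶜ : Finset (Fin p)), residualCov W σ O j j ≤ σ ^ 2 * (1 + (1 - σ ^ 2) /
        (σ ^ 2 + sigmaMin (rowsOf W O) ^ 2)) := by
    intro j
    have h1 := dotProduct_residualCov_mulVec_le W h (Pi.single j 1)
    have h2 : (rowsOf W Oᶜ)ᵀ.mulVec (Pi.single j 1) ⬝ᵥ (rowsOf W Oᶜ)ᵀ.mulVec (Pi.single j 1) =
        1 - σ ^ 2 := by
      have := hW j
      simp only [Matrix.add_apply, Matrix.smul_apply, one_apply_eq, smul_eq_mul, mul_one, mul_apply,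
        transpose_apply] at this
      rw [← eq_sub_iff_add_eq] at this
      rw [← this]
      simp [dotProduct, rowsOf]
    rw [h2] at h1
    simpa using h1
  calc (residualCov W σ O).trace ≤ ∑ j : (Oᶜ : Finset (Fin p)), σ ^ 2 * (1 + (1 - σ ^ 2) /
        (σ ^ 2 + sigmaMin (rowsOf W O) ^ 2)) := Finset.sum_le_sum fun j _ => hj j
    _ = _ := by simp

end Residual

/-! ### Linear images of Gaussian vectors, and independence from zero covariance. -/

namespace ProbabilityTheory

open Matrix WithLp

section MultivariateGaussian

variable {ι κ κ' : Type*} [Fintype ι] [DecidableEq ι] [Fintype κ] [DecidableEq κ]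
  [Fintype κ'] [DecidableEq κ']

theorem multivariateGaussian_zero_map_toEuclideanLin {S : Matrix ι ι ℝ} (hS : S.PosSemidef)
    (R : Matrix κ ι ℝ) :
    (multivariateGaussian 0 S).map (toEuclideanLin R) =
      multivariateGaussian 0 (R * S * Rᵀ) := by
  have hRS : (R * S * Rᵀ).PosSemidef := by
    simpa using hS.mul_mul_conjTranspose_same R
  let T : EuclideanSpace ℝ ι →L[ℝ] EuclideanSpace ℝ κ :=
    LinearMap.toContinuousLinearMap (toEuclideanLin R)
  have hT : ∀ u, T.adjoint u = toEuclideanLin Rᵀ u := by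
    intro u
    refine ext_inner_right ℝ fun v => ?_
    rw [ContinuousLinearMap.adjoint_inner_left]
    simp only [T, LinearMap.coe_toContinuousLinearMap', PiLp.inner_apply, RCLike.inner_apply,
      conj_trivial, ofLp_toLpLin, toLin'_apply]
    simp_rw [mul_comm _ (ofLp u _), mul_comm (ofLp v _)]
    change u.ofLp ⬝ᵥ R *ᵥ v.ofLp = (Rᵀ *ᵥ u.ofLp) ⬝ᵥ v.ofLp
    rw [mulVec_transpose, dotProduct_mulVec]
  change (multivariateGaussian 0 S).map T = _
  apply IsGaussian.ext
  · simp only [id_eq, integral_id_multivariateGaussian]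
    rw [ContinuousLinearMap.integral_id_map, integral_id_multivariateGaussian, map_zero]
    exact IsGaussian.integrable_id
  · ext u v
    rw [covarianceBilin_map IsGaussian.memLp_two_id, covarianceBilin_multivariateGaussian hS,
      covarianceBilin_multivariateGaussian hRS, hT, hT]
    simp only [ofLp_toLpLin, toLin'_apply]
    rw [← mulVec_mulVec, ← mulVec_mulVec, dotProduct_mulVec u.ofLp, mulVec_transpose R u.ofLp]

omit [Fintype κ] [DecidableEq κ] [Fintype κ'] [DecidableEq κ'] in
theorem covariance_mulVec_multivariateGaussian {S : Matrix ι ι ℝ} (hS : S.PosSemidef)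
    (R : Matrix κ ι ℝ) (P : Matrix κ' ι ℝ) (i : κ) (j : κ') :
    cov[fun v => R.mulVec v.ofLp i, fun v => P.mulVec v.ofLp j; multivariateGaussian 0 S] =
      (R * S * Pᵀ) i j := by
  have h : ∀ w : ι → ℝ, (fun v : EuclideanSpace ℝ ι => w ⬝ᵥ v.ofLp) =
      fun v => inner ℝ (toLp 2 w) v := by
    intro w
    ext v
    simp [PiLp.inner_apply, dotProduct, mul_comm]
  change cov[fun v : EuclideanSpace ℝ ι => R i ⬝ᵥ v.ofLp,
    fun v : EuclideanSpace ℝ ι => P j ⬝ᵥ v.ofLp; _] = _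
  rw [h, h, ← covarianceBilin_apply_eq_cov IsGaussian.memLp_two_id,
    covarianceBilin_multivariateGaussian hS]
  simp [Matrix.mul_apply, dotProduct, mulVec, Finset.mul_sum, Finset.sum_mul, mul_assoc]
  exact Finset.sum_comm

omit [DecidableEq κ] [DecidableEq κ'] in
theorem indepFun_mulVec_of_multivariateGaussian {Ω : Type*} [MeasurableSpace Ω] {μ : Measure Ω}
    {S : Matrix ι ι ℝ} (hS : S.PosSemidef)
    {z : Ω → EuclideanSpace ℝ ι} (hz : HasLaw z (multivariateGaussian 0 S) μ)
    {R : Matrix κ ι ℝ} {P : Matrix κ' ι ℝ} (h : R * S * Pᵀ = 0) :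
    IndepFun (fun ω => R.mulVec (z ω).ofLp) (fun ω => P.mulVec (z ω).ofLp) μ := by
  refine HasGaussianLaw.indepFun_of_covariance_eval
    (X := fun i ω => R.mulVec (z ω).ofLp i) (Y := fun j ω => P.mulVec (z ω).ofLp j) ?_ ?_
  · let f : EuclideanSpace ℝ ι →ₗ[ℝ] (κ → ℝ) × (κ' → ℝ) :=
      (R.mulVecLin.prod P.mulVecLin) ∘ₗ (WithLp.linearEquiv 2 ℝ (ι → ℝ)).toLinearMap
    exact hz.hasGaussianLaw.map (LinearMap.toContinuousLinearMap f)
  · intro i j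
    have := hz.covariance_fun_comp (f := fun v => R.mulVec v.ofLp i)
      (g := fun v => P.mulVec v.ofLp j) (by fun_prop) (by fun_prop)
    rw [this, covariance_mulVec_multivariateGaussian hS, h]
    rfl

end MultivariateGaussian

/-! ### Chernoff bound for the squared norm of a Gaussian vector. -/

section ChiSquared

theorem integrable_exp_mul_sq_gaussianReal {v : NNReal} {l : ℝ} (h : 2 * l * v < 1) :
    Integrable (fun y => Real.exp (l * y ^ 2)) (gaussianReal 0 v) := by
  by_cases hv : v = 0
  · rw [hv, gaussianReal_zero_var]
    exact integrable_dirac (by simp)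
  have hv' : 0 < (v : ℝ) := by positivity
  rw [gaussianReal_of_var_ne_zero _ hv, gaussianPDF_def,
    integrable_withDensity_iff_integrable_smul' (by fun_prop) (by simp)]
  have : 0 < (2 * (v : ℝ))⁻¹ - l := by
    rw [sub_pos, ← one_div, lt_div_iff₀ (by positivity)]
    linarith
  refine ((integrable_exp_neg_mul_sq this).const_mul (√(2 * Real.pi * v))⁻¹).congr
    (ae_of_all _ fun y => ?_)
  simp only [smul_eq_mul]
  rw [ENNReal.toReal_ofReal (gaussianPDFReal_nonneg _ _ _), gaussianPDFReal, mul_assoc _ (Real.exp _),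
    ← Real.exp_add]
  congr 2
  field_simp
  ring

theorem integral_exp_mul_sq_gaussianReal {v : NNReal} {l : ℝ} (h : 2 * l * v < 1) :
    ∫ y, Real.exp (l * y ^ 2) ∂(gaussianReal 0 v) = (√(1 - 2 * l * v))⁻¹ := by
  by_cases hv : v = 0
  · simp [hv]
  have hv' : 0 < (v : ℝ) := by positivity
  have hb : 0 < (2 * (v : ℝ))⁻¹ - l := by
    rw [sub_pos, ← one_div, lt_div_iff₀ (by positivity)]
    linarith
  rw [integral_gaussianReal_eq_integral_smul hv]
  have h1 : ∀ y, gaussianPDFReal 0 v y • Real.exp (l * y ^ 2) =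
      (√(2 * Real.pi * v))⁻¹ * Real.exp (-((2 * (v : ℝ))⁻¹ - l) * y ^ 2) := by
    intro y
    rw [smul_eq_mul, gaussianPDFReal, mul_assoc _ (Real.exp _), ← Real.exp_add]
    congr 2
    field_simp
    ring
  simp_rw [h1]
  rw [integral_const_mul, integral_gaussian, ← Real.sqrt_inv, ← Real.sqrt_inv,
    ← Real.sqrt_mul (by positivity)]
  congr 1
  have : 1 - 2 * l * v ≠ 0 := by linarith
  have h2 : ((2 * (v : ℝ))⁻¹ - l) = (1 - 2 * l * v) / (2 * v) := by field_simp
  rw [h2]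
  field_simp

/-- Uses `u ≤ e^{u-1}` at `u = (1 - 2ls)⁻¹`. Replacing `s` by `B` in the denominator makes the
exponent linear in `s`, so a product over eigenvalues depends only on their sum. -/
theorem inv_sqrt_one_sub_le_exp {l s B : ℝ} (hl : 0 ≤ l) (hs : 0 ≤ s) (hsB : s ≤ B)
    (hB : 2 * l * B < 1) :
    (√(1 - 2 * l * s))⁻¹ ≤ Real.exp (l * s / (1 - 2 * l * B)) := by
  have hlt : 2 * l * s ≤ 2 * l * B := by gcongr
  have ha : 0 < 1 - 2 * l * s := by linarith
  rw [← Real.sqrt_inv]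
  calc √(1 - 2 * l * s)⁻¹ ≤ √(Real.exp ((1 - 2 * l * s)⁻¹ - 1)) := by
        gcongr
        linarith [Real.add_one_le_exp ((1 - 2 * l * s)⁻¹ - 1)]
    _ = Real.exp (l * s / (1 - 2 * l * s)) := by
        rw [← Real.exp_half]
        congr 1
        field_simp
        ring
    _ ≤ _ := by
        have : 0 < 1 - 2 * l * B := by linarith
        gcongr

theorem exists_chernoff_parameter {T B t : ℝ} (hT : 0 < T) (hB : 0 < B) (ht : 0 < t) :
    ∃ l : ℝ, 0 ≤ l ∧ 2 * l * B < 1 ∧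
      -l * (√T + √(2 * B * t)) ^ 2 + l * T / (1 - 2 * l * B) = -t := by
  set a := √T with ha
  set d := √(2 * B * t) with hd
  have ha0 : 0 < a := Real.sqrt_pos.mpr hT
  have hd0 : 0 < d := Real.sqrt_pos.mpr (by positivity)
  have haT : T = a ^ 2 := (Real.sq_sqrt hT.le).symm
  have hdt : t = d ^ 2 / (2 * B) := by
    rw [Real.sq_sqrt (by positivity)]
    field_simp
  have h1 : 1 - 2 * (d / (a + d) / (2 * B)) * B = a / (a + d) := by
    field_simp
    ring
  -- The minimiser of the exponent: its derivative vanishes when `(1 - 2lB)² = T / (a + d)²`.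
  refine ⟨d / (a + d) / (2 * B), by positivity, ?_, ?_⟩
  · have : 0 < a / (a + d) := by positivity
    linarith
  · rw [h1, haT, hdt]
    field_simp
    ring

/-- In an eigenbasis of `S` the coordinates are independent centred Gaussians with the eigenvalues
as variances, so the exponential moment of `‖x‖²` factorises. -/
theorem multivariateGaussian_norm_sq_tail {ι : Type*} [Fintype ι] [DecidableEq ι]
    {S : Matrix ι ι ℝ} (hS : S.PosSemidef) {T B t : ℝ} (hT : 0 < T) (hB : 0 < B) (ht : 0 < t)
    (htr : S.trace ≤ T) (hq : ∀ v, v ⬝ᵥ S.mulVec v ≤ B * (v ⬝ᵥ v)) :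
    (multivariateGaussian 0 S).real {x | (√T + √(2 * B * t)) ^ 2 ≤ ‖x‖ ^ 2} ≤ Real.exp (-t) := by
  set ν := multivariateGaussian 0 S
  set e := hS.1.eigenvectorBasis
  set ev := hS.1.eigenvalues
  have hev : ∀ i, S *ᵥ (e i).ofLp = ev i • (e i).ofLp := hS.1.mulVec_eigenvectorBasis
  have hinner : ∀ i j, (e i).ofLp ⬝ᵥ (e j).ofLp = if i = j then 1 else 0 := by
    intro i j
    rw [← orthonormal_iff_ite.mp e.orthonormal i j]
    simp [PiLp.inner_apply, dotProduct, mul_comm]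
  have hev0 : ∀ i, 0 ≤ ev i := hS.eigenvalues_nonneg
  have hevB : ∀ i, ev i ≤ B := by
    intro i
    have := hq (e i).ofLp
    rw [hev, dotProduct_smul, hinner] at this
    simpa using this
  have hevT : ∑ i, ev i ≤ T := by
    rw [hS.1.trace_eq_sum_eigenvalues] at htr
    simpa using htr
  have hcov : ∀ i j, cov[fun x => inner ℝ (e i) x, fun x => inner ℝ (e j) x; ν] =
      if i = j then ev i else 0 := by
    intro i j
    rw [← covarianceBilin_apply_eq_cov IsGaussian.memLp_two_id,
      covarianceBilin_multivariateGaussian hS, hev, dotProduct_smul, hinner]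
    split_ifs with h <;> simp [h]
  let Y : ι → EuclideanSpace ℝ ι → ℝ := fun i x => inner ℝ (e i) x
  have hgauss : HasGaussianLaw (fun x => (Y · x)) ν :=
    (IsGaussian.hasGaussianLaw_id (μ := ν)).map
      (ContinuousLinearMap.pi fun i => innerSL ℝ (e i))
  have hYm : ∀ i, Measurable (Y i) := fun i => by fun_prop
  have hind : iIndepFun Y ν := hgauss.iIndepFun_of_covariance_eq_zero fun i j hij => by
    rw [hcov, if_neg hij]
  have hmap : ∀ i, ν.map (Y i) = gaussianReal 0 (ev i).toNNReal := by
    intro i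
    rw [(hgauss.eval i).map_eq_gaussianReal, ← covariance_self (hYm i).aemeasurable, hcov,
      if_pos rfl]
    congr 1
    have := ContinuousLinearMap.integral_comp_id_comm (μ := ν) IsGaussian.integrable_id
      (innerSL ℝ (e i))
    simpa [ν] using this
  obtain ⟨l, hl, hlB, hlt⟩ := exists_chernoff_parameter hT hB ht
  have hlt' : ∀ i, 2 * l * ((ev i).toNNReal : ℝ) < 1 := by
    intro i
    rw [Real.coe_toNNReal _ (hev0 i)]
    exact lt_of_le_of_lt (by gcongr; exact hevB i) hlB
  let Z : ι → EuclideanSpace ℝ ι → ℝ := fun i x => Y i x ^ 2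
  have hZm : ∀ i, Measurable (Z i) := fun i => by fun_prop
  have hZind : iIndepFun Z ν := hind.comp (fun _ y => y ^ 2) fun _ => by fun_prop
  have hZmgf : ∀ i, mgf (Z i) ν l ≤ Real.exp (l * ev i / (1 - 2 * l * B)) := by
    intro i
    have : mgf (Z i) ν l = ∫ y, Real.exp (l * y ^ 2) ∂(ν.map (Y i)) := by
      rw [integral_map (hYm i).aemeasurable (by fun_prop)]
      rfl
    rw [this, hmap, integral_exp_mul_sq_gaussianReal (hlt' i), Real.coe_toNNReal _ (hev0 i)]
    exact inv_sqrt_one_sub_le_exp hl (hev0 i) (hevB i) hlB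
  have hZint : ∀ i, Integrable (fun x => Real.exp (l * Z i x)) ν := by
    intro i
    have := integrable_exp_mul_sq_gaussianReal (hlt' i)
    rw [← hmap] at this
    exact this.comp_measurable (hYm i)
  have hnorm : ∀ x : EuclideanSpace ℝ ι, ‖x‖ ^ 2 = (∑ i, Z i) x := by
    intro x
    rw [Finset.sum_apply, ← e.sum_sq_inner_right x]
  have hset : {x : EuclideanSpace ℝ ι | (√T + √(2 * B * t)) ^ 2 ≤ ‖x‖ ^ 2} =
      {x | (√T + √(2 * B * t)) ^ 2 ≤ (∑ i, Z i) x} := by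
    ext x
    simp only [Set.mem_ofPred_eq, hnorm]
  have hint : Integrable (fun x => Real.exp (l * (∑ i, Z i) x)) ν :=
    hZind.integrable_exp_mul_sum hZm fun i _ => hZint i
  rw [hset]
  refine (measure_ge_le_exp_mul_mgf _ hl hint).trans ?_
  rw [hZind.mgf_sum hZm]
  calc Real.exp (-l * (√T + √(2 * B * t)) ^ 2) * ∏ i, mgf (Z i) ν l
      ≤ Real.exp (-l * (√T + √(2 * B * t)) ^ 2) *
        ∏ i, Real.exp (l * ev i / (1 - 2 * l * B)) := by
        gcongr with i
        · exact fun i _ => mgf_nonneg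
        · exact hZmgf i
    _ = Real.exp (-l * (√T + √(2 * B * t)) ^ 2 + l * (∑ i, ev i) / (1 - 2 * l * B)) := by
        rw [← Real.exp_sum, ← Real.exp_add, ← Finset.sum_div, Finset.mul_sum]
    _ ≤ Real.exp (-l * (√T + √(2 * B * t)) ^ 2 + l * T / (1 - 2 * l * B)) := by
        have : 0 < 1 - 2 * l * B := by linarith
        gcongr
    _ = Real.exp (-t) := by rw [hlt]

end ChiSquared

end ProbabilityTheory

/-! ### Law of the latent vector and conditioning on the observed entries. -/

open Matrix in
theorem ppca_eq_multivariateGaussian {p k : ℕ} (W : Matrix (Fin p) (Fin k) ℝ) (σ : ℝ) :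
    ppca W σ = multivariateGaussian 0 (ppcaCov W σ) := by
  have hW : (W * Wᵀ).PosSemidef := by simpa using posSemidef_self_mul_conjTranspose W
  have hσ : (σ ^ 2 • (1 : Matrix (Fin p) (Fin p) ℝ)).PosSemidef :=
    PosSemidef.one.smul (sq_nonneg σ)
  have hC : (ppcaCov W σ).PosSemidef := hW.add hσ
  have hmeas : Measurable (toEuclideanLin W) :=
    (LinearMap.continuous_of_finiteDimensional _).measurable
  have h1 : ppca W σ = ((multivariateGaussian 0 (W * Wᵀ)).prod
      (multivariateGaussian (0 : EuclideanSpace ℝ (Fin p))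
      (σ ^ 2 • (1 : Matrix (Fin p) (Fin p) ℝ)))).map (fun q => q.1 + q.2) := by
    have := multivariateGaussian_zero_map_toEuclideanLin
      (PosSemidef.one (n := Fin k) (R := ℝ)) W
    rw [Matrix.mul_one] at this
    have h2 := Measure.map_prod_map (multivariateGaussian 0 (1 : Matrix (Fin k) (Fin k) ℝ))
      (multivariateGaussian (0 : EuclideanSpace ℝ (Fin p))
        (σ ^ 2 • (1 : Matrix (Fin p) (Fin p) ℝ))) hmeas measurable_id
    rw [Measure.map_id, this] at h2
    rw [h2, Measure.map_map (by fun_prop) (by fun_prop)]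
    rfl
  rw [h1]
  apply Measure.ext_of_charFun
  ext u
  rw [ charFun_map_add_prod_eq_mul, Pi.mul_apply, charFun_multivariateGaussian hW,
    charFun_multivariateGaussian hσ, charFun_multivariateGaussian hC, ← Complex.exp_add]
  congr 1
  simp [ppcaCov, add_mulVec]
  ring

theorem condExp_comap_eq_of_indepFun {Ω β : Type*} [mΩ : MeasurableSpace Ω] [mβ : MeasurableSpace β]
    {μ : Measure Ω} [IsProbabilityMeasure μ] {X : Ω → β} (hX : Measurable X) {f h r : Ω → ℝ}
    (hf : f = h + r) {φ : β → ℝ} (hφ : Measurable φ) (hh : h =ᵐ[μ] φ ∘ X)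
    (hint : Integrable h μ) (hr : Integrable r μ) (hind : IndepFun r X μ) (h0 : ∫ ω, r ω ∂μ = 0) :
    μ[f | mβ.comap X] =ᵐ[μ] h := by
  have hle : mβ.comap X ≤ mΩ := hX.comap_le
  have h1 : μ[h | mβ.comap X] =ᵐ[μ] φ ∘ X := by
    refine (condExp_congr_ae hh).trans (Filter.EventuallyEq.of_eq ?_)
    exact condExp_of_stronglyMeasurable hle
      (hφ.comp (comap_measurable X)).stronglyMeasurable (hint.congr hh)
  have h2 : μ[r | mβ.comap X] =ᵐ[μ] fun _ => 0 := by
    -- `r` is only a.e. measurable, so independence is transferred to a measurable version.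
    have hm := hr.aemeasurable
    have hind' : IndepFun (hm.mk r) X μ := hind.congr hm.ae_eq_mk (Filter.EventuallyEq.refl _ _)
    have h3 := condExp_indep_eq hm.measurable_mk.comap_le hle
      (comap_measurable (hm.mk r)).stronglyMeasurable hind'
    rw [← integral_congr_ae hm.ae_eq_mk, h0] at h3
    exact (condExp_congr_ae hm.ae_eq_mk).trans h3
  rw [hf]
  filter_upwards [condExp_add hint hr (mβ.comap X), h1, h2, hh] with ω a b c d
  rw [a, Pi.add_apply, b, c, d, add_zero]

/-! ### From the imputation error to the Gaussian residual. -/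

section Imputation

open Matrix

variable {Ω : Type*} [MeasurableSpace Ω] {μ : Measure Ω} [IsProbabilityMeasure μ]
  {p k : ℕ} {W : Matrix (Fin p) (Fin k) ℝ} {σ : ℝ} {g : Fin p → ℝ → ℝ}
  {x z : Ω → EuclideanSpace ℝ (Fin p)} {O : Finset (Fin p)}

theorem posSemidef_ppcaCov (W : Matrix (Fin p) (Fin k) ℝ) (σ : ℝ) :
    (ppcaCov W σ).PosSemidef := by
  have hW : (W * Wᵀ).PosSemidef := by simpa using posSemidef_self_mul_conjTranspose W
  exact hW.add (PosSemidef.one.smul (sq_nonneg σ))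

theorem rowSelector_mulVec (S : Finset (Fin p)) (v : Fin p → ℝ) :
    (rowSelector S).mulVec v = fun i : S => v i := by
  ext i
  simp [rowSelector, rowsOf, mulVec, dotProduct, one_apply]

omit [IsProbabilityMeasure μ] in
theorem hasLaw_residual (hz : HasLaw z (ppca W σ) μ)
    (h : 0 < σ ^ 2 + sigmaMin (rowsOf W O) ^ 2) :
    HasLaw (fun ω => toEuclideanLin (residualMatrix W σ O) (z ω))
      (multivariateGaussian 0 (residualCov W σ O)) μ := by
  rw [ppca_eq_multivariateGaussian] at hz
  have hm : Measurable (toEuclideanLin (residualMatrix W σ O)) :=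
    (LinearMap.continuous_of_finiteDimensional _).measurable
  have h1 := multivariateGaussian_zero_map_toEuclideanLin (posSemidef_ppcaCov W σ)
    (residualMatrix W σ O)
  rw [residualMatrix_mul_cov_mul_self W h] at h1
  exact HasLaw.fun_comp ⟨hm.aemeasurable, h1⟩ hz

omit [IsProbabilityMeasure μ] in
theorem integral_clm_latent (hz : HasLaw z (ppca W σ) μ)
    (f : EuclideanSpace ℝ (Fin p) →L[ℝ] ℝ) : ∫ ω, f (z ω) ∂μ = 0 := by
  rw [ppca_eq_multivariateGaussian] at hz
  have h1 := hz.integral_comp (f := f) (by fun_prop)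
  have h2 := f.integral_comp_id_comm
    (μ := multivariateGaussian 0 (ppcaCov W σ)) IsGaussian.integrable_id
  rw [integral_id_multivariateGaussian, map_zero] at h2
  exact h1.trans h2

theorem condExp_latent_eq (hx : IsLRGC μ W σ g x z) (hg : ∀ j, MeasurableEmbedding (g j))
    (h : 0 < σ ^ 2 + sigmaMin (rowsOf W O) ^ 2) (j : (Oᶜ : Finset (Fin p))) :
    μ[fun ω => z ω j | observedSigma x O] =ᵐ[μ]
      fun ω => z ω j - toEuclideanLin (residualMatrix W σ O) (z ω) j := by
  have hz := hx.law_latent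
  rw [ppca_eq_multivariateGaussian] at hz
  have hX : Measurable (fun (ω : Ω) (i : O) => x ω (i : Fin p)) := by
    have := hx.measurable
    fun_prop
  let res : EuclideanSpace ℝ (Fin p) →L[ℝ] ℝ :=
    EuclideanSpace.proj j ∘L LinearMap.toContinuousLinearMap (toEuclideanLin (residualMatrix W σ O))
  have hres : ∀ v, res v = toEuclideanLin (residualMatrix W σ O) v j := fun v => rfl
  have hreg : ∀ v : EuclideanSpace ℝ (Fin p), v j - res v =
      (regressionMatrix W σ O).mulVec (fun i : O => v i) j := by
    intro v
    rw [hres, ofLp_toLpLin, toLin'_apply, residualMatrix, sub_mulVec, ← mulVec_mulVec,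
      rowSelector_mulVec, rowSelector_mulVec]
    simp
  -- `ψ j` is a measurable left inverse of `g j` on all of `ℝ`, although `g j` need not be onto; it
  -- recovers `z_O` from `x_O`.
  choose ψ hψ hψg using fun j => (hg j).exists_measurable_extend measurable_id fun _ => ⟨(0 : ℝ)⟩
  have hzint : Integrable (fun ω => z ω j) μ :=
    (hz.hasGaussianLaw.map_fun (EuclideanSpace.proj (j : Fin p))).integrable
  have hrint : Integrable (fun ω => res (z ω)) μ := (hz.hasGaussianLaw.map_fun res).integrable
  have hind : IndepFun (fun ω => res (z ω)) (fun (ω : Ω) (i : O) => x ω (i : Fin p)) μ := by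
    have h1 := indepFun_mulVec_of_multivariateGaussian (posSemidef_ppcaCov W σ) hz
      (residualMatrix_mul_cov_mul_observed W h)
    have hφ : Measurable fun v : (Oᶜ : Finset (Fin p)) → ℝ => v j := measurable_pi_apply j
    have hψ' : Measurable fun (v : O → ℝ) (i : O) => g i (v i) :=
      measurable_pi_lambda _ fun i => (hg i).measurable.comp (measurable_pi_apply i)
    have h2 := h1.comp hφ hψ'
    refine h2.congr (Filter.EventuallyEq.of_eq rfl) ?_
    filter_upwards [hx.eq_apply] with ω hω
    ext i
    simp only [Function.comp_apply, rowSelector_mulVec, hω]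
  refine condExp_comap_eq_of_indepFun (X := fun (ω : Ω) (i : O) => x ω (i : Fin p)) hX
    (f := fun ω => z ω j) (h := fun ω => z ω j - res (z ω)) (r := fun ω => res (z ω))
    (by ext; simp)
    (φ := fun y => (regressionMatrix W σ O).mulVec (fun i : O => ψ i (y i)) j) ?_ ?_
    (hzint.sub hrint) hrint hind (integral_clm_latent hx.law_latent res)
  · have : ∀ i : O, Measurable (fun y : O → ℝ => ψ i (y i)) := fun i =>
      (hψ i).comp (measurable_pi_apply i)
    simp only [mulVec, dotProduct]
    fun_prop
  · filter_upwards [hx.eq_apply] with ω hω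
    rw [hreg]
    simp only [Function.comp_apply, hω]
    congr 1
    ext i
    exact (congrFun (hψg i) (z ω i)).symm

theorem imputationMSE_le_ae (hx : IsLRGC μ W σ g x z) (hg : ∀ j, MeasurableEmbedding (g j))
    {L : NNReal} (hL : ∀ j, LipschitzWith L (g j))
    (h : 0 < σ ^ 2 + sigmaMin (rowsOf W O) ^ 2) :
    ∀ᵐ ω ∂μ, imputationMSE μ g x z O ω ≤
      (L : ℝ) ^ 2 * ‖toEuclideanLin (residualMatrix W σ O) (z ω)‖ ^ 2 / (Oᶜ.card : ℝ) := by
  have h1 := ae_all_iff.mpr (condExp_latent_eq (O := O) hx hg h)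
  filter_upwards [h1] with ω hω
  rw [imputationMSE, EuclideanSpace.real_norm_sq_eq, Finset.mul_sum, ← Finset.sum_coe_sort]
  gcongr with j
  have h2 := (hL j).dist_le_mul ((μ[fun ω' => z ω' j | observedSigma x O]) ω) (z ω j)
  rw [Real.dist_eq, Real.dist_eq, hω j] at h2
  rw [impute, hω j, ← mul_pow, ← sq_abs]
  calc _ ≤ (L * |z ω j - toEuclideanLin (residualMatrix W σ O) (z ω) j - z ω j|) ^ 2 := by gcongr
    _ = _ := by rw [sub_right_comm, sub_self, zero_sub, abs_neg, mul_pow, sq_abs, mul_pow]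

theorem sq_le_one_of_unit_diag (j : Fin p)
    (hj : (W * W.transpose + σ ^ 2 • (1 : Matrix (Fin p) (Fin p) ℝ)) j j = 1) : σ ^ 2 ≤ 1 := by
  simp only [Matrix.add_apply, Matrix.smul_apply, one_apply_eq, smul_eq_mul, mul_one, mul_apply,
    transpose_apply] at hj
  have : 0 ≤ ∑ i, W j i * W j i := Finset.sum_nonneg fun i _ => mul_self_nonneg _
  linarith

omit [IsProbabilityMeasure μ] in
theorem measureReal_residual_norm_sq_ge_le (hx : IsLRGC μ W σ g x z)
    (h : 0 < σ ^ 2 + sigmaMin (rowsOf W O) ^ 2) (hσ : σ ≠ 0) (hO : 0 < Oᶜ.card)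
    {t : ℝ} (ht : 0 < t) :
    μ.real {ω | (Oᶜ.card : ℝ) * (σ ^ 2 *
        (√(1 + (1 - σ ^ 2) / (σ ^ 2 + sigmaMin (rowsOf W O) ^ 2)) +
          √(2 * (1 + sigmaMax (rowsOf W Oᶜ) ^ 2 / (σ ^ 2 + sigmaMin (rowsOf W O) ^ 2)) *
            (t / (Oᶜ.card : ℝ)))) ^ 2) ≤
        ‖toEuclideanLin (residualMatrix W σ O) (z ω)‖ ^ 2} ≤ Real.exp (-t) := by
  set c := σ ^ 2 + sigmaMin (rowsOf W O) ^ 2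
  set a := 1 + (1 - σ ^ 2) / c with ha
  set b := 1 + sigmaMax (rowsOf W Oᶜ) ^ 2 / c with hb
  have hm : 0 < (Oᶜ.card : ℝ) := by exact_mod_cast hO
  obtain ⟨j, -⟩ := Finset.card_pos.mp hO
  have hσ1 : 0 ≤ 1 - σ ^ 2 := sub_nonneg.mpr (sq_le_one_of_unit_diag j (hx.unit_diag j))
  have hapos : 0 < a := by positivity
  have hbpos : 0 < b := by positivity
  have hσ2 : 0 < σ ^ 2 := by positivity
  have hS : (residualCov W σ O).PosSemidef := by
    rw [← residualMatrix_mul_cov_mul_self W h]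
    simpa using (posSemidef_ppcaCov W σ).mul_mul_conjTranspose_same (residualMatrix W σ O)
  have htail := multivariateGaussian_norm_sq_tail hS
    (T := (Oᶜ.card : ℝ) * (σ ^ 2 * a)) (B := σ ^ 2 * b) (by positivity) (by positivity) ht
    (trace_residualCov_le W h hx.unit_diag) (dotProduct_residualCov_mulVec_le_sigmaMax W h)
  -- The common factor `√(|M| σ²)` is pulled out of both roots.
  have hK : (√((Oᶜ.card : ℝ) * (σ ^ 2 * a)) + √(2 * (σ ^ 2 * b) * t)) ^ 2 =
      (Oᶜ.card : ℝ) * (σ ^ 2 * (√a + √(2 * b * (t / (Oᶜ.card : ℝ)))) ^ 2) := by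
    have h1 : (Oᶜ.card : ℝ) * (σ ^ 2 * a) = ((Oᶜ.card : ℝ) * σ ^ 2) * a := by ring
    have h2 : 2 * (σ ^ 2 * b) * t =
        ((Oᶜ.card : ℝ) * σ ^ 2) * (2 * b * (t / (Oᶜ.card : ℝ))) := by field_simp
    rw [h1, h2, Real.sqrt_mul (x := (Oᶜ.card : ℝ) * σ ^ 2) (by positivity),
      Real.sqrt_mul (x := (Oᶜ.card : ℝ) * σ ^ 2) (by positivity), ← mul_add, mul_pow,
      Real.sq_sqrt (by positivity), mul_assoc]
  rw [hK] at htail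
  have hlaw := (hasLaw_residual hx.law_latent h).measureReal_eq
    (p := fun v => (Oᶜ.card : ℝ) * (σ ^ 2 * (√a + √(2 * b * (t / (Oᶜ.card : ℝ)))) ^ 2) ≤ ‖v‖ ^ 2)
    (measurableSet_le measurable_const (by fun_prop))
  rw [← hlaw] at htail
  exact htail

omit [IsProbabilityMeasure μ] in
theorem residual_ae_eq_zero (hz : HasLaw z (ppca W σ) μ)
    (h : 0 < σ ^ 2 + sigmaMin (rowsOf W O) ^ 2) (hσ : σ = 0) :
    ∀ᵐ ω ∂μ, toEuclideanLin (residualMatrix W σ O) (z ω) = 0 := by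
  have h1 := hasLaw_residual hz h
  have h2 : residualCov W σ O = 0 := by simp [residualCov, hσ]
  have h3 : multivariateGaussian (0 : EuclideanSpace ℝ (Oᶜ : Finset (Fin p))) 0 =
      Measure.dirac 0 := by
    simp [multivariateGaussian]
  rw [h2, h3] at h1
  exact h1.ae_eq_of_dirac

end Imputation

/-! ### The tail bound, with the degenerate cases `M = ∅` and `σ = 0` apart. -/

theorem theorem3 {Ω : Type*} [MeasurableSpace Ω] (μ : Measure Ω) [IsProbabilityMeasure μ]
    {p k : ℕ} (W : Matrix (Fin p) (Fin k) ℝ) (σ : ℝ) (g : Fin p → ℝ → ℝ)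
    (x z : Ω → EuclideanSpace ℝ (Fin p)) (hx : IsLRGC μ W σ g x z)
    (L : NNReal) (hg : ∀ j, StrictMono (g j) ∨ StrictAnti (g j))
    (hL : ∀ j, LipschitzWith L (g j))
    (O : Finset (Fin p)) (hpos : 0 < σ ^ 2 + sigmaMin (rowsOf W O) ^ 2)
    (t : ℝ) (ht : 0 < t) :
    μ.real {ω | imputationMSE μ g x z O ω >
        (L : ℝ) ^ 2 * σ ^ 2 *
          (Real.sqrt (1 + (1 - σ ^ 2) / (σ ^ 2 + sigmaMin (rowsOf W O) ^ 2)) +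
            Real.sqrt (2 * (1 + sigmaMax (rowsOf W Oᶜ) ^ 2 /
              (σ ^ 2 + sigmaMin (rowsOf W O) ^ 2)) * (t / (Oᶜ.card : ℝ)))) ^ 2}
      ≤ Real.exp (-t) := by
  have hemb : ∀ j, MeasurableEmbedding (g j) := fun j =>
    (hL j).continuous.measurableEmbedding ((hg j).elim StrictMono.injective StrictAnti.injective)
  have hle := imputationMSE_le_ae hx hemb hL hpos
  rcases Oᶜ.card.eq_zero_or_pos with hO | hO
  · rw [measureReal_def, measure_mono_null_ae (t := ∅) ?_ measure_empty, ENNReal.toReal_zero]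
    · positivity
    refine Filter.Eventually.of_forall fun ω h1 => ?_
    -- Division by `|M| = 0` yields `0`, so the event is empty.
    have h0 : imputationMSE μ g x z O ω = 0 := by simp [imputationMSE, hO]
    exact absurd h1 (not_lt.mpr (h0.le.trans (by positivity)))
  by_cases hσ : σ = 0
  · rw [measureReal_def, measure_mono_null_ae (t := ∅) ?_ measure_empty, ENNReal.toReal_zero]
    · positivity
    filter_upwards [hle, residual_ae_eq_zero hx.law_latent hpos hσ] with ω h1 h2 h3
    rw [h2] at h1
    simp only [norm_zero, ne_eq, OfNat.ofNat_ne_zero, not_false_eq_true, zero_pow, mul_zero,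
      zero_div] at h1
    exact absurd h3 (not_lt.mpr (h1.trans (by positivity)))
  refine le_trans ?_ (measureReal_residual_norm_sq_ge_le hx hpos hσ hO ht)
  refine ENNReal.toReal_mono (measure_ne_top _ _) (measure_mono_ae ?_)
  filter_upwards [hle] with ω h1 h2
  have hm : 0 < (Oᶜ.card : ℝ) := by exact_mod_cast hO
  have h3 := lt_of_lt_of_le h2 h1
  rw [lt_div_iff₀ hm, mul_assoc, mul_assoc] at h3
  -- Cancelling `L²` from a strict inequality needs only `0 ≤ L²`, so `L = 0` is covered.
  have h4 := lt_of_mul_lt_mul_left h3 (by positivity)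
  change _ ≤ _
  linarith
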